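/- All matroids are finite. Let $\mathcal{A}=(A_i : i\in[r])$ be a sequence of subsets of a finite set $E$, where $[r]=\{1,\dots,r\}$. The transversal matroid $M[\mathcal{A}]$ is the matroid on $E$ whose independent sets are the partial transversals of $\mathcal{A}$, that is, the sets $X\subseteq E$ for which there is an injection $\phi:X\to[r]$ with $e\in A_{\phi(e)}$ for all $e\in X$; $\mathcal{A}$ is called a presentation of $M$ if $M=M[\mathcal{A}]$. For a matroid $M$ of rank $r$ we consider only presentations by $r$ sets, ordered by $\mathcal{A}\preceq\mathcal{B}$ if and only if $A_i\subseteq B_i$ for all $i\in[r]$; the rank of a presentation is its rank in this ranked ordered set, that is, the length of the longest chain of presentations of $M$ that ends at it. Fix an element $x\notin E(M)$. For $I\subseteq[r]$, let $\mathcal{A}^I$ be obtained from $\mathcal{A}$ by adjoining $x$ to $A_i$ for each $i\in I$, so that $M[\mathcal{A}^I]$ is a transversal matroid on $E(M)\cup\{x\}$. Let $T_{\mathcal{A}}=\{M[\mathcal{A}^I] : I\subseteq[r]\}$, let $$\sigma_{\mathcal{A}}(I)=I\cup\{k\in[r]-I : x \text{ is a coloop of } M[\mathcal{A}^I]\backslash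 A_k\},$$ and let $L_{\mathcal{A}}=\{I\subseteq[r] : \sigma_{\mathcal{A}}(I)=I\}$. **Theorem.** Let $r\ge 1$, let $M$ be a transversal matroid of rank $r$, and let $\mathcal{A}=(A_i : i\in[r])$ be a presentation of $M$ of rank $i$ in the ordered set of presentations of $M$. If $1\le i<r$, then $$|T_{\mathcal{A}}|=|L_{\mathcal{A}}|\le\Bigl(\frac12+\frac1{2^{i+1}}\Bigr)2^r .$$ These bounds are sharp: for all $r$ and $i$ with $1\le i<r$, there are a transversal matroid $M$ of rank $r$ and a presentation $\mathcal{A}$ of $M$ of rank $i$ for which equality holds. If $i\ge r$, then $|T_{\mathcal{A}}|=|L_{\mathcal{A}}|\le 2^{r-1}$. -/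

import Mathlib

namespace TransversalMatroid

/-- `φ` is an `A`-matching of `X` into `[r]`: an injection with `e ∈ A_{φ(e)}` for all `e ∈ X`. -/
def IsMatching {α : Type*} {r : ℕ} (A : Fin r → Set α) (X : Set α) (φ : X → Fin r) : Prop :=
  Function.Injective φ ∧ ∀ e : X, (e : α) ∈ A (φ e)

/-- `X` is a partial transversal of the set system `A = (A_i : i ∈ [r])`. -/
def IsPartialTransversal {α : Type*} {r : ℕ} (A : Fin r → Set α) (X : Set α) : Prop :=
  ∃ φ : X → Fin r, IsMatching A X φ

theorem IsPartialTransversal.subset {α : Type*} {r : ℕ} {A : Fin r → Set α} {X Y : Set α}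
    (hY : IsPartialTransversal A Y) (hXY : X ⊆ Y) : IsPartialTransversal A X := by
  obtain ⟨φ, hinj, hmem⟩ := hY
  exact ⟨fun e => φ (Set.inclusion hXY e), hinj.comp (Set.inclusion_injective hXY),
    fun e => hmem (Set.inclusion hXY e)⟩

theorem IsPartialTransversal.encard_le {α : Type*} {r : ℕ} {A : Fin r → Set α} {X : Set α}
    (hX : IsPartialTransversal A X) : X.encard ≤ r := by
  obtain ⟨φ, hinj, -⟩ := hX
  have h := ENat.card_le_card_of_injective hinj
  rw [ENat.card_eq_coe_fintype_card (α := Fin r), Fintype.card_fin] at h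
  exact h

/-- Partial transversals described through a globally defined partial function. -/
theorem isPartialTransversal_iff {α : Type*} {r : ℕ} {A : Fin r → Set α} {X : Set α} :
    IsPartialTransversal A X ↔
      ∃ φ : α → Option (Fin r), Set.InjOn φ X ∧ ∀ e ∈ X, ∃ i, φ e = some i ∧ e ∈ A i := by
  classical
  constructor
  · rintro ⟨φ, hinj, hmem⟩
    refine ⟨fun e => if h : e ∈ X then some (φ ⟨e, h⟩) else none, ?_, ?_⟩
    · intro a ha b hb hab
      simp only [dif_pos ha, dif_pos hb, Option.some.injEq] at hab
      exact congrArg Subtype.val (hinj hab)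
    · intro e he
      exact ⟨φ ⟨e, he⟩, by simp [he], hmem ⟨e, he⟩⟩
  · rintro ⟨φ, hinj, hmem⟩
    choose f hf hfA using hmem
    refine ⟨fun e => f e.1 e.2, ?_, fun e => hfA e.1 e.2⟩
    intro a b hab
    apply Subtype.ext
    apply hinj a.2 b.2
    rw [hf a.1 a.2, hf b.1 b.2]
    exact congrArg some hab

/-- The augmentation property of partial transversals (Edmonds and Fulkerson). -/
theorem IsPartialTransversal.augment {α : Type*} {r : ℕ} {A : Fin r → Set α} {X Y : Set α}
    (hX : IsPartialTransversal A X) (hY : IsPartialTransversal A Y) (hlt : X.encard < Y.encard) :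
    ∃ e ∈ Y, e ∉ X ∧ IsPartialTransversal A (insert e X) := by
  classical
  have hXfin : X.Finite := Set.finite_of_encard_le_coe hX.encard_le
  obtain ⟨φ, hφ, hφA⟩ := isPartialTransversal_iff.1 hX
  obtain ⟨ψ, hψ, hψA⟩ := isPartialTransversal_iff.1 hY
  -- Induct on the number of elements of `X` on which `φ` and `ψ` differ.
  induction hn : {e ∈ X | φ e ≠ ψ e}.ncard using Nat.strong_induction_on generalizing φ with
  | _ n ih =>
    have hlt' : (φ '' X).encard < (ψ '' Y).encard := by
      rwa [hφ.encard_image, hψ.encard_image]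
    obtain ⟨j, ⟨e, heY, rfl⟩, hj⟩ : ∃ j ∈ ψ '' Y, j ∉ φ '' X := by
      by_contra! h
      exact absurd (Set.encard_le_encard (show ψ '' Y ⊆ φ '' X from h)) (not_le.2 hlt')
    have hupd : ∀ a ∈ X, a ≠ e → Function.update φ e (ψ e) a = φ a :=
      fun a _ hae => Function.update_of_ne hae _ _
    have hinj : Set.InjOn (Function.update φ e (ψ e)) (insert e X) := by
      intro a ha b hb hab
      by_cases hae : a = e <;> by_cases hbe : b = e
      · rw [hae, hbe]
      · subst hae
        have hbX : b ∈ X := hb.resolve_left hbe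
        rw [Function.update_self, Function.update_of_ne hbe] at hab
        exact absurd ⟨b, hbX, hab.symm⟩ hj
      · subst hbe
        have haX : a ∈ X := ha.resolve_left hae
        rw [Function.update_self, Function.update_of_ne hae] at hab
        exact absurd ⟨a, haX, hab⟩ hj
      · rw [Function.update_of_ne hbe, Function.update_of_ne hae] at hab
        exact hφ (ha.resolve_left hae) (hb.resolve_left hbe) hab
    have hmem : ∀ a ∈ insert e X, ∃ i, Function.update φ e (ψ e) a = some i ∧ a ∈ A i := by
      intro a ha
      by_cases hae : a = e
      · subst hae
        rw [Function.update_self]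
        exact hψA a heY
      · rw [Function.update_of_ne hae]
        exact hφA a (ha.resolve_left hae)
    by_cases heX : e ∈ X
    · rw [Set.insert_eq_of_mem heX] at hinj hmem
      refine ih _ ?_ (Function.update φ e (ψ e)) hinj hmem rfl
      rw [← hn]
      apply Set.ncard_lt_ncard _ (hXfin.subset (Set.sep_subset _ _))
      refine ⟨?_, ?_⟩
      · rintro a ⟨haX, ha⟩
        refine ⟨haX, ?_⟩
        by_cases hae : a = e
        · subst hae
          exact absurd (Function.update_self ..) ha
        · rwa [Function.update_of_ne hae] at ha
      · intro hsub
        have hne : φ e ≠ ψ e := fun h => hj ⟨e, heX, h⟩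
        exact (hsub (show e ∈ {a ∈ X | φ a ≠ ψ a} from ⟨heX, hne⟩)).2 (Function.update_self ..)
    · exact ⟨e, heY, heX, isPartialTransversal_iff.2 ⟨_, hinj, hmem⟩⟩

/-- The transversal matroid `M[A]` on the ground set `E`: its independent sets are the partial
transversals of `A` contained in `E`. -/
def transversalMatroid {α : Type*} {r : ℕ} (E : Set α) (A : Fin r → Set α) : Matroid α :=
  (IndepMatroid.ofBddAugment E (fun X => X ⊆ E ∧ IsPartialTransversal A X)
    ⟨Set.empty_subset E, fun e => absurd e.2 (Set.notMem_empty _),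
      fun e => absurd e.2 (Set.notMem_empty _), fun e => absurd e.2 (Set.notMem_empty _)⟩
    (fun _ _ hY hXY => ⟨hXY.trans hY.1, hY.2.subset hXY⟩)
    (fun _ _ hX hY hlt => by
      obtain ⟨e, heY, heX, h⟩ := hX.2.augment hY.2 hlt
      exact ⟨e, heY, heX, Set.insert_subset (hY.1 heY) hX.1, h⟩)
    ⟨r, fun _ hX => hX.2.encard_le⟩
    (fun _ hX => hX.1)).matroid

theorem transversalMatroid_ground {α : Type*} {r : ℕ} (E : Set α) (A : Fin r → Set α) :
    (transversalMatroid E A).E = E := rfl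

theorem transversalMatroid_indep_iff {α : Type*} {r : ℕ} (E : Set α) (A : Fin r → Set α)
    (X : Set α) :
    (transversalMatroid E A).Indep X ↔ X ⊆ E ∧ IsPartialTransversal A X := Iff.rfl

/-- The presentations of `M` by `r` sets. As a subtype of `Fin r → Set α` it carries the
order `A ≼ B ↔ ∀ i, A i ⊆ B i`. -/
abbrev Presentation {α : Type*} (M : Matroid α) (r : ℕ) : Type _ :=
  {A : Fin r → Set α // (∀ i, A i ⊆ M.E) ∧ transversalMatroid M.E A = M}

/-- The set system `A^I`: the element `x` is adjoined to the sets `A_i` with `i ∈ I`. -/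
def extendSystem {α : Type*} {r : ℕ} (A : Fin r → Set α) (x : α) (I : Set (Fin r)) :
    Fin r → Set α :=
  fun i => A i ∪ {y | y = x ∧ i ∈ I}

/-- The matroid `M[A^I]` on `E(M) ∪ {x}`, where `A` is a presentation of `M`. -/
def extension {α : Type*} {M : Matroid α} {r : ℕ} (A : Presentation M r) (x : α)
    (I : Set (Fin r)) : Matroid α :=
  transversalMatroid (insert x M.E) (extendSystem A.1 x I)

/-- `σ_A(I) = I ∪ {k ∉ I : x is a coloop of M[A^I] \ A_k}`. -/
def sigma {α : Type*} {M : Matroid α} {r : ℕ} (A : Presentation M r) (x : α)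
    (I : Set (Fin r)) : Set (Fin r) :=
  I ∪ {k | k ∉ I ∧ ((extension A x I).delete (A.1 k)).IsColoop x}

/-- `L_A`: the `σ_A`-closed subsets of `[r]`. -/
def closedSets {α : Type*} {M : Matroid α} {r : ℕ} (A : Presentation M r) (x : α) :
    Set (Set (Fin r)) :=
  {I | sigma A x I = I}

/-- `T_A`: the single-element extensions of `M` by `x` that have a presentation extending `A`. -/
def extensions {α : Type*} {M : Matroid α} {r : ℕ} (A : Presentation M r) (x : α) :
    Set (Matroid α) :=
  {N | ∃ I : Set (Fin r), N = extension A x I}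

end TransversalMatroid

namespace TransversalMatroid

/-! A set `X ∪ {x}` with `X ⊆ E(M)` is independent in `M[A^I]` exactly when `X` has an `A`-matching
that leaves some index of `I` free for `x`. Hence adding `k` to `I` leaves the extension unchanged
iff every `X` that can be matched without `k` can be matched without some `j ∈ I`. An exchange
argument (`mem_sigma_iff_forall_avoiding`) shows that this is what `k ∈ σ(I)` means, although the
coloop condition only tests sets disjoint from `A_k`. So `σ(I)` is the largest index set defining
the same extension as `I`, and `T_A` and `L_A` are in bijection.

For the bound, match a basis of `M \ A_k` into `[r]`. If a closed set contains an index `j` that the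
matching misses, it contains `k`. Each `k` thus yields at least `r - 1 - r(M \ A_k)` implications
"`j ∈ I` gives `k ∈ I`" with `j ≠ k`. The sum of these deficiencies increases strictly with the
presentation, so it is at least the rank `i`. A family of subsets of `[r]` closed under `i` such
implications has at most `(1/2 + 1/2^(i+1)) 2^r` members (`card_closedUnder_le`).

Equality holds when all implications share one conclusion: the free matroid with `A_0 = {0, …, i}`
and `A_k = {k}` otherwise. -/

open Set

/-! ### Counting sets closed under binary implications -/

/-- The subsets of `S` that respect every implication `b ∈ I → a ∈ I` with `R a b`. -/
noncomputable def closedUnder {V : Type*} [DecidableEq V] (R : V → V → Prop) (S : Finset V) :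
    Finset (Finset V) :=
  open Classical in S.powerset.filter fun I => ∀ a ∈ S, ∀ b ∈ S, R a b → b ∈ I → a ∈ I

/-- The pairs of distinct elements of `S` that are related by `R`. -/
noncomputable def offDiagPairs {V : Type*} [DecidableEq V] (R : V → V → Prop) (S : Finset V) :
    Finset (V × V) :=
  open Classical in S.offDiag.filter fun p => R p.1 p.2

theorem mem_closedUnder {V : Type*} [DecidableEq V] {R : V → V → Prop} {S I : Finset V} :
    I ∈ closedUnder R S ↔ I ⊆ S ∧ ∀ a ∈ S, ∀ b ∈ S, R a b → b ∈ I → a ∈ I := by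
  simp [closedUnder]

theorem card_offDiagPairs_insert {V : Type*} [DecidableEq V] (R : V → V → Prop) {S : Finset V}
    {v : V} (hv : v ∉ S) [DecidablePred (R · v)] [DecidablePred (R v)] :
    (offDiagPairs R (insert v S)).card =
      (offDiagPairs R S).card + (S.filter (R · v)).card + (S.filter (R v)).card := by
  classical
  have h : offDiagPairs R (insert v S) =
      (offDiagPairs R S ∪ (S.filter (R · v)).image (fun a => (a, v))) ∪
        (S.filter (R v)).image (fun b => (v, b)) := by
    ext ⟨a, b⟩
    simp only [offDiagPairs, Finset.mem_filter, Finset.mem_offDiag, Finset.mem_insert,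
      Finset.mem_union, Finset.mem_image, Prod.mk.injEq]
    constructor
    · rintro ⟨⟨rfl | ha, rfl | hb, hab⟩, hR⟩
      · exact absurd rfl hab
      · exact .inr ⟨b, ⟨hb, hR⟩, rfl, rfl⟩
      · exact .inl (.inr ⟨a, ⟨ha, hR⟩, rfl, rfl⟩)
      · exact .inl (.inl ⟨⟨ha, hb, hab⟩, hR⟩)
    · rintro ((⟨⟨ha, hb, hab⟩, hR⟩ | ⟨c, ⟨hc, hR⟩, rfl, rfl⟩) | ⟨c, ⟨hc, hR⟩, rfl, rfl⟩)
      · exact ⟨⟨.inr ha, .inr hb, hab⟩, hR⟩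
      · exact ⟨⟨.inr hc, .inl rfl, fun h => hv (h ▸ hc)⟩, hR⟩
      · exact ⟨⟨.inl rfl, .inr hc, fun h => hv (h ▸ hc)⟩, hR⟩
  rw [h, Finset.card_union_of_disjoint, Finset.card_union_of_disjoint,
    Finset.card_image_of_injective _ (Prod.mk_left_injective v),
    Finset.card_image_of_injective _ (Prod.mk_right_injective v)]
  · rw [Finset.disjoint_left]
    rintro ⟨a, b⟩ h1 h2
    simp only [offDiagPairs, Finset.mem_filter, Finset.mem_offDiag, Finset.mem_image,
      Prod.mk.injEq] at h1 h2
    obtain ⟨c, -, -, rfl⟩ := h2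
    exact hv h1.1.2.1
  · rw [Finset.disjoint_left]
    rintro ⟨a, b⟩ h1 h2
    simp only [offDiagPairs, Finset.mem_filter, Finset.mem_offDiag, Finset.mem_image,
      Finset.mem_union, Prod.mk.injEq] at h1 h2
    obtain ⟨c, -, rfl, -⟩ := h2
    rcases h1 with h1 | ⟨d, hd, rfl, -⟩
    · exact hv h1.1.1
    · exact hv hd.1

/-- A system of `m` implications between distinct elements of a set of size `n` has at most
`(1/2 + 1/2^(m+1)) 2^n` closed sets. -/
theorem card_closedUnder_le {V : Type*} [DecidableEq V] (R : V → V → Prop) (S : Finset V) :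
    ((closedUnder R S).card : ℝ) ≤
      2 ^ S.card * (1 / 2 + 1 / 2 * (1 / 2) ^ (offDiagPairs R S).card) := by
  classical
  induction S using Finset.induction_on with
  | empty =>
    have : closedUnder R (∅ : Finset V) = {∅} := by ext; simp +contextual [mem_closedUnder]
    simp [this, offDiagPairs]
    norm_num
  | insert v S hv ih =>
    rw [card_offDiagPairs_insert R hv, Finset.card_insert_of_notMem hv]
    -- Closed sets containing `v` must contain `P`; those missing `v` must avoid `Q`. Each class is
    -- bounded both by this constraint and by the closed sets of `S`.
    set P := S.filter (R · v)
    set Q := S.filter (R v)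
    set C := closedUnder R (insert v S)
    have hsplit : C.card = (C.filter (v ∈ ·)).card + (C.filter (v ∉ ·)).card :=
      (Finset.card_filter_add_card_filter_not _).symm
    have herase : Set.InjOn (fun I : Finset V => I.erase v) (C.filter (v ∈ ·)) := by
      intro I hI J hJ h
      rw [Finset.mem_coe, Finset.mem_filter] at hI hJ
      rw [← Finset.insert_erase hI.2, ← Finset.insert_erase hJ.2]
      exact congrArg _ h
    have hcl : ∀ I ∈ C, I.erase v ∈ closedUnder R S := by
      intro I hI
      obtain ⟨hIS, hI⟩ := mem_closedUnder.1 hI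
      refine mem_closedUnder.2 ⟨Finset.subset_insert_iff.1 hIS, fun a ha b hb hab hbI => ?_⟩
      refine Finset.mem_erase.2 ⟨fun h => hv (h ▸ ha), ?_⟩
      exact hI a (Finset.mem_insert_of_mem ha) b (Finset.mem_insert_of_mem hb) hab
        (Finset.mem_of_mem_erase hbI)
    have hA1 : (C.filter (v ∈ ·)).card ≤ (closedUnder R S).card := by
      refine Finset.card_le_card_of_injOn _ (fun I hI => ?_) herase
      exact hcl I (Finset.mem_filter.1 hI).1
    have hB1 : (C.filter (v ∉ ·)).card ≤ (closedUnder R S).card := by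
      refine Finset.card_le_card fun I hI => ?_
      obtain ⟨hI, hvI⟩ := Finset.mem_filter.1 hI
      simpa [Finset.erase_eq_of_notMem hvI] using hcl I hI
    have hA2 : (C.filter (v ∈ ·)).card ≤ 2 ^ (S.card - P.card) := by
      rw [← Finset.card_Icc_finset (Finset.filter_subset _ _)]
      refine Finset.card_le_card_of_injOn _ (fun I hI => ?_) herase
      obtain ⟨hI, hvI⟩ := Finset.mem_filter.1 hI
      refine Finset.mem_coe.2 (Finset.mem_Icc.2 ⟨fun a ha => ?_, (mem_closedUnder.1 (hcl I hI)).1⟩)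
      obtain ⟨haS, ha⟩ := Finset.mem_filter.1 ha
      refine Finset.mem_erase.2 ⟨fun h => hv (h ▸ haS), ?_⟩
      exact (mem_closedUnder.1 hI).2 a (Finset.mem_insert_of_mem haS) v
        (Finset.mem_insert_self _ _) ha hvI
    have hB2 : (C.filter (v ∉ ·)).card ≤ 2 ^ (S.card - Q.card) := by
      rw [← Finset.card_sdiff_of_subset (Finset.filter_subset _ _), ← Finset.card_powerset]
      refine Finset.card_le_card fun I hI => ?_
      obtain ⟨hI, hvI⟩ := Finset.mem_filter.1 hI
      refine Finset.mem_powerset.2 fun b hb => ?_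
      have hbS : b ∈ S := (Finset.mem_insert.1 ((mem_closedUnder.1 hI).1 hb)).resolve_left
        fun h => hvI (h ▸ hb)
      refine Finset.mem_sdiff.2 ⟨hbS, fun h => hvI ?_⟩
      exact (mem_closedUnder.1 hI).2 v (Finset.mem_insert_self _ _) b
        (Finset.mem_insert_of_mem hbS) (Finset.mem_filter.1 h).2 hb
    have hpow : ∀ d ≤ S.card, (2 : ℝ) ^ (S.card - d) = 2 ^ S.card * (1 / 2) ^ d := by
      intro d hd
      rw [pow_sub₀ _ two_ne_zero hd, one_div, inv_pow]
    have hA3 : ((C.filter (v ∈ ·)).card : ℝ) ≤ 2 ^ S.card * (1 / 2) ^ P.card := by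
      rw [← hpow _ (Finset.card_filter_le _ _)]
      exact_mod_cast hA2
    have hB3 : ((C.filter (v ∉ ·)).card : ℝ) ≤ 2 ^ S.card * (1 / 2) ^ Q.card := by
      rw [← hpow _ (Finset.card_filter_le _ _)]
      exact_mod_cast hB2
    have hA4 : ((C.filter (v ∈ ·)).card : ℝ) ≤ (closedUnder R S).card := by exact_mod_cast hA1
    have hB4 : ((C.filter (v ∉ ·)).card : ℝ) ≤ (closedUnder R S).card := by exact_mod_cast hB1
    rw [hsplit]
    push_cast
    rw [pow_succ, pow_add ((1 : ℝ) / 2) (_ + _), pow_add]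
    have hhalf : ∀ d : ℕ, d ≠ 0 → ((1 : ℝ) / 2) ^ d ≤ 1 / 2 := fun d hd =>
      pow_le_of_le_one (by norm_num) (by norm_num) hd
    have hb0 : (0 : ℝ) < (1 / 2) ^ (offDiagPairs R S).card := by positivity
    have hb1 : ((1 : ℝ) / 2) ^ (offDiagPairs R S).card ≤ 1 :=
      pow_le_one₀ (by norm_num) (by norm_num)
    have hp0 : (0 : ℝ) < (1 / 2) ^ P.card := by positivity
    have hq0 : (0 : ℝ) < (1 / 2) ^ Q.card := by positivity
    have hN : (0 : ℝ) < 2 ^ S.card := by positivity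
    -- After division by `2 ^ S.card` this is `(1/2 - a) * (1 - b) ≥ 0`. It handles the cases where
    -- exactly one of `P`, `Q` is empty.
    have key : ∀ a b : ℝ, a ≤ 1 / 2 → b ≤ 1 →
        (2 : ℝ) ^ S.card * a + 2 ^ S.card * (1 / 2 + 1 / 2 * b) ≤
          2 ^ S.card * 2 * (1 / 2 + 1 / 2 * (b * a)) := by
      intro a b ha hb
      have := mul_nonneg hN.le (mul_nonneg (sub_nonneg.2 ha) (sub_nonneg.2 hb))
      nlinarith
    rcases eq_or_ne P.card 0 with hp | hp <;> rcases eq_or_ne Q.card 0 with hq | hq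
    · rw [hp, hq, pow_zero]
      linarith
    · have := key _ _ (hhalf _ hq) hb1
      rw [hp, pow_zero, mul_one]
      linarith
    · have := key _ _ (hhalf _ hp) hb1
      rw [hq, pow_zero, mul_one]
      linarith
    -- With both `P` and `Q` nonempty, each class has at most half of the subsets of `S`, so the
    -- main term `1/2` of the bound already suffices.
    · have h1 := mul_le_mul_of_nonneg_left (hhalf _ hp) hN.le
      have h2 := mul_le_mul_of_nonneg_left (hhalf _ hq) hN.le
      have h3 := mul_pos hN (mul_pos (mul_pos hb0 hp0) hq0)
      linarith

/-! ### Matchings that leave an index free -/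

variable {α : Type*} {r : ℕ} {M : Matroid α}

/-- `X` has an `A`-matching that does not use the index `k`. -/
def IsAvoidingTransversal (A : Fin r → Set α) (k : Fin r) (X : Set α) : Prop :=
  ∃ φ : X → Fin r, IsMatching A X φ ∧ ∀ e, φ e ≠ k

theorem IsAvoidingTransversal.isPartialTransversal {A : Fin r → Set α} {k : Fin r} {X : Set α}
    (h : IsAvoidingTransversal A k X) : IsPartialTransversal A X :=
  let ⟨φ, hφ, _⟩ := h
  ⟨φ, hφ⟩

theorem IsAvoidingTransversal.subset {A : Fin r → Set α} {k : Fin r} {X Y : Set α}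
    (hY : IsAvoidingTransversal A k Y) (hXY : X ⊆ Y) : IsAvoidingTransversal A k X := by
  obtain ⟨φ, ⟨hinj, hmem⟩, hk⟩ := hY
  exact ⟨fun e => φ (inclusion hXY e), ⟨hinj.comp (inclusion_injective hXY),
    fun e => hmem (inclusion hXY e)⟩, fun e => hk _⟩

theorem IsPartialTransversal.congr {A B : Fin r → Set α} {X : Set α}
    (h : ∀ e ∈ X, ∀ i, e ∈ A i → e ∈ B i) (hX : IsPartialTransversal A X) :
    IsPartialTransversal B X :=
  let ⟨φ, hφ, hA⟩ := hX
  ⟨φ, hφ, fun e => h e e.2 _ (hA e)⟩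

theorem IsAvoidingTransversal.congr {A B : Fin r → Set α} {k : Fin r} {X : Set α}
    (h : ∀ e ∈ X, ∀ i, e ∈ A i → e ∈ B i) (hX : IsAvoidingTransversal A k X) :
    IsAvoidingTransversal B k X :=
  let ⟨φ, ⟨hφ, hA⟩, hk⟩ := hX
  ⟨φ, ⟨hφ, fun e => h e e.2 _ (hA e)⟩, hk⟩

theorem IsPartialTransversal.avoiding {A : Fin r → Set α} {k : Fin r} {X : Set α}
    (hX : IsPartialTransversal A X) (hk : ∀ e ∈ X, e ∉ A k) : IsAvoidingTransversal A k X :=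
  let ⟨φ, hφ⟩ := hX
  ⟨φ, hφ, fun e he => hk e e.2 (he ▸ hφ.2 e)⟩

/-- Makes the sets matched without `k` the independent sets of a transversal matroid, so that they
can be extended to bases. -/
theorem isPartialTransversal_update_iff {A : Fin r → Set α} {k : Fin r} {X : Set α} :
    IsPartialTransversal (Function.update A k ∅) X ↔ IsAvoidingTransversal A k X := by
  constructor
  · intro h
    refine (h.avoiding (k := k) (by simp)).congr fun e _ i hi => ?_
    rcases eq_or_ne i k with rfl | hik
    · simp at hi
    · rwa [Function.update_of_ne hik] at hi
  · rintro ⟨φ, ⟨hinj, hmem⟩, hk⟩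
    refine ⟨φ, hinj, fun e => ?_⟩
    rw [Function.update_of_ne (hk e)]
    exact hmem e

theorem IsAvoidingTransversal.encard_add_one_le {A : Fin r → Set α} {k : Fin r} {X : Set α}
    (h : IsAvoidingTransversal A k X) : X.encard + 1 ≤ r := by
  obtain ⟨φ, ⟨hinj, -⟩, hk⟩ := h
  have h1 : (range φ).encard = X.encard := by
    rw [← image_univ, hinj.encard_image, encard_univ, ENat.card_coe_set_eq]
  have h2 : k ∉ range φ := fun ⟨e, he⟩ => hk e he
  rw [← h1, ← encard_insert_of_notMem h2]
  refine (encard_le_encard (subset_univ _)).trans ?_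
  simp

theorem isPartialTransversal_insert_iff {A : Fin r → Set α} {e : α} {X : Set α} (he : e ∉ X) :
    IsPartialTransversal A (insert e X) ↔ ∃ k, e ∈ A k ∧ IsAvoidingTransversal A k X := by
  classical
  constructor
  · rintro ⟨φ, hinj, hmem⟩
    refine ⟨φ ⟨e, mem_insert _ _⟩, hmem ⟨e, mem_insert _ _⟩,
      fun a => φ ⟨a, mem_insert_of_mem _ a.2⟩, ⟨fun a b hab => ?_, fun a => hmem _⟩, fun a ha => ?_⟩
    · exact Subtype.ext (Subtype.mk.inj (hinj hab))
    · exact he (Subtype.mk.inj (hinj ha) ▸ a.2)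
  · rintro ⟨k, hek, φ, ⟨hinj, hmem⟩, hk⟩
    have hX : ∀ a : (insert e X : Set α), (a : α) ≠ e → (a : α) ∈ X := fun a ha =>
      a.2.resolve_left ha
    refine ⟨fun a => if h : (a : α) = e then k else φ ⟨a, hX a h⟩, fun a b hab => ?_, fun a => ?_⟩
    · apply Subtype.ext
      by_cases ha : (a : α) = e <;> by_cases hb : (b : α) = e <;>
        simp only [ha, hb, dite_true, dite_false] at hab ⊢
      · exact absurd hab.symm (hk _)
      · exact absurd hab (hk _)
      · exact Subtype.mk.inj (hinj hab)
    · by_cases ha : (a : α) = e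
      · simpa [ha] using hek
      · simpa [ha] using hmem ⟨a, hX a ha⟩

/-! ### Independence in the extensions `M[A^I]` -/

theorem mem_extendSystem_of_ne {A : Fin r → Set α} {x e : α} {I : Set (Fin r)} {i : Fin r}
    (he : e ≠ x) : e ∈ extendSystem A x I i ↔ e ∈ A i := by
  simp [extendSystem, he]

theorem mem_extendSystem_self {A : Fin r → Set α} {x : α} {I : Set (Fin r)} {i : Fin r}
    (hx : x ∉ A i) : x ∈ extendSystem A x I i ↔ i ∈ I := by
  simp [extendSystem, hx]

theorem isPartialTransversal_extendSystem_iff {A : Fin r → Set α} {x : α} {I : Set (Fin r)}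
    {X : Set α} (hx : x ∉ X) :
    IsPartialTransversal (extendSystem A x I) X ↔ IsPartialTransversal A X := by
  have h : ∀ e ∈ X, ∀ i, e ∈ extendSystem A x I i ↔ e ∈ A i := fun e he i =>
    mem_extendSystem_of_ne fun h => hx (h ▸ he)
  exact ⟨.congr fun e he i => (h e he i).1, .congr fun e he i => (h e he i).2⟩

theorem isAvoidingTransversal_extendSystem_iff {A : Fin r → Set α} {x : α} {I : Set (Fin r)}
    {X : Set α} {k : Fin r} (hx : x ∉ X) :
    IsAvoidingTransversal (extendSystem A x I) k X ↔ IsAvoidingTransversal A k X := by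
  have h : ∀ e ∈ X, ∀ i, e ∈ extendSystem A x I i ↔ e ∈ A i := fun e he i =>
    mem_extendSystem_of_ne fun h => hx (h ▸ he)
  exact ⟨.congr fun e he i => (h e he i).1, .congr fun e he i => (h e he i).2⟩

theorem isPartialTransversal_extendSystem_insert_iff {A : Fin r → Set α} {x : α}
    {I : Set (Fin r)} {X : Set α} (hx : x ∉ X) (hxA : ∀ i, x ∉ A i) :
    IsPartialTransversal (extendSystem A x I) (insert x X) ↔
      ∃ k ∈ I, IsAvoidingTransversal A k X := by
  rw [isPartialTransversal_insert_iff hx]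
  simp only [mem_extendSystem_self (hxA _), isAvoidingTransversal_extendSystem_iff hx]

theorem Presentation.indep_iff (A : Presentation M r) {X : Set α} (hX : X ⊆ M.E) :
    M.Indep X ↔ IsPartialTransversal A.1 X := by
  conv_lhs => rw [← A.2.2]
  rw [transversalMatroid_indep_iff, and_iff_right hX]

theorem Presentation.notMem (A : Presentation M r) {x : α} (hx : x ∉ M.E) (i : Fin r) :
    x ∉ A.1 i := fun h => hx (A.2.1 i h)

theorem Presentation.encard_le (A : Presentation M r) {X : Set α} (hX : M.Indep X) :
    X.encard ≤ r :=
  ((A.indep_iff hX.subset_ground).1 hX).encard_le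

theorem extension_indep_iff (A : Presentation M r) {x : α} (hx : x ∉ M.E) {I : Set (Fin r)}
    {X : Set α} (hX : X ⊆ M.E) : (extension A x I).Indep X ↔ M.Indep X := by
  rw [A.indep_iff hX, extension, transversalMatroid_indep_iff,
    and_iff_right (hX.trans (subset_insert _ _)),
    isPartialTransversal_extendSystem_iff fun h => hx (hX h)]

theorem extension_indep_insert_iff (A : Presentation M r) {x : α} (hx : x ∉ M.E)
    {I : Set (Fin r)} {X : Set α} (hX : X ⊆ M.E) :
    (extension A x I).Indep (insert x X) ↔ ∃ k ∈ I, IsAvoidingTransversal A.1 k X := by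
  rw [extension, transversalMatroid_indep_iff, and_iff_right (insert_subset_insert hX),
    isPartialTransversal_extendSystem_insert_iff (fun h => hx (hX h)) (A.notMem hx)]

theorem extension_eq_iff (A : Presentation M r) {x : α} (hx : x ∉ M.E) {I J : Set (Fin r)} :
    extension A x I = extension A x J ↔ ∀ X ⊆ M.E,
      ((∃ k ∈ I, IsAvoidingTransversal A.1 k X) ↔ ∃ k ∈ J, IsAvoidingTransversal A.1 k X) := by
  constructor
  · intro h X hX
    rw [← extension_indep_insert_iff A hx hX, h, extension_indep_insert_iff A hx hX]
  · intro h
    refine Matroid.ext_indep rfl fun Y hY => ?_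
    have hYE : Y \ {x} ⊆ M.E := by
      rintro e ⟨heY, hex⟩
      exact (hY heY).resolve_left hex
    by_cases hxY : x ∈ Y
    · rw [← insert_sdiff_self_of_mem hxY, extension_indep_insert_iff A hx hYE,
        extension_indep_insert_iff A hx hYE]
      exact h _ hYE
    · rw [sdiff_singleton_eq_self hxY] at hYE
      rw [extension_indep_iff A hx hYE, extension_indep_iff A hx hYE]

/-! ### The operator `σ` in terms of matchings -/

/-- A base of `M[A^I] \ A_k` that misses `x` is independent in `M \ A_k`, hence no larger than `X`;
this is impossible once `X ∪ {x}` is independent. One basis therefore decides the coloop condition.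
-/
theorem isColoop_iff_of_isBasis (A : Presentation M r) {x : α} (hx : x ∉ M.E)
    {I : Set (Fin r)} {k : Fin r} {X : Set α} (hX : M.IsBasis X (M.E \ A.1 k)) :
    ((extension A x I).delete (A.1 k)).IsColoop x ↔ ∃ j ∈ I, IsAvoidingTransversal A.1 j X := by
  have hXE : X ⊆ M.E := hX.indep.subset_ground
  have hxk := A.notMem hx k
  have hdisj : Disjoint X (A.1 k) := disjoint_left.2 fun e he => (hX.subset he).2
  rw [← extension_indep_insert_iff A hx hXE]
  constructor
  · intro h
    have := h.insert_indep_of_indep (I := X)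
      (((extension_indep_iff A hx hXE).2 hX.indep).indep_delete_of_disjoint hdisj)
    exact this.of_delete
  · intro h
    have h' := h.indep_delete_of_disjoint (D := A.1 k) (disjoint_insert_left.2 ⟨hxk, hdisj⟩)
    rw [Matroid.isColoop_iff_forall_mem_isBase]
    intro B hB
    by_contra hxB
    have hBE : B ⊆ M.E \ A.1 k := by
      intro e he
      obtain ⟨h1, h2⟩ := hB.subset_ground he
      exact ⟨h1.resolve_left fun h => hxB (h ▸ he), h2⟩
    have hBi : M.Indep B :=
      (extension_indep_iff A hx (hBE.trans sdiff_subset)).1 hB.indep.of_delete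
    have h1 := h'.encard_le_eRank
    rw [← hB.encard_eq_eRank, encard_insert_of_notMem fun h => hx (hXE h)] at h1
    have h2 := (hBi.encard_le_eRk_of_subset hBE).trans_eq hX.eRk_eq_encard
    have hfin : X.encard ≠ ⊤ := ne_top_of_le_ne_top (ENat.natCast_ne_top r) (A.encard_le hX.indep)
    exact absurd (h1.trans h2) (not_le.2 ((ENat.lt_add_one_iff hfin).2 le_rfl))

theorem mem_sigma_iff_of_isBasis (A : Presentation M r) {x : α} (hx : x ∉ M.E)
    {I : Set (Fin r)} {k : Fin r} (hk : k ∉ I) {X : Set α} (hX : M.IsBasis X (M.E \ A.1 k)) :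
    k ∈ sigma A x I ↔ ∃ j ∈ I, IsAvoidingTransversal A.1 j X := by
  rw [← isColoop_iff_of_isBasis A hx hX]
  simp [sigma, hk]

theorem mem_sigma_iff (A : Presentation M r) {x : α} (hx : x ∉ M.E)
    {I : Set (Fin r)} {k : Fin r} (hk : k ∉ I) :
    k ∈ sigma A x I ↔
      ∀ X ⊆ M.E \ A.1 k, M.Indep X → ∃ j ∈ I, IsAvoidingTransversal A.1 j X := by
  constructor
  · intro h X hX hXi
    obtain ⟨B, hB, hXB⟩ := hXi.subset_isBasis_of_subset hX
    obtain ⟨j, hj, hjB⟩ := (mem_sigma_iff_of_isBasis A hx hk hB).1 h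
    exact ⟨j, hj, hjB.subset hXB⟩
  · intro h
    obtain ⟨B, hB⟩ := M.exists_isBasis (M.E \ A.1 k)
    exact (mem_sigma_iff_of_isBasis A hx hk hB).2 (h B hB.subset hB.indep)

theorem mem_closedSets_iff {A : Presentation M r} {x : α} {I : Set (Fin r)} :
    I ∈ closedSets A x ↔ ∀ k ∈ sigma A x I, k ∈ I :=
  ⟨fun h k hk => by rwa [show sigma A x I = I from h] at hk,
    fun h => Subset.antisymm h subset_union_left⟩

/-- Given `X` matched without `k`, the set `(X \ A_k) ∪ {x}` is independent in `M[A^I]` and meets no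
set of index `k`. Extended inside `X ∪ {x}` without using `k`, it loses at most one element, which
lies in `A_k` and can be matched to the free index `k`. -/
theorem mem_sigma_iff_forall_avoiding (A : Presentation M r) {x : α} (hx : x ∉ M.E)
    {I : Set (Fin r)} {k : Fin r} :
    k ∈ sigma A x I ↔ ∀ X ⊆ M.E, IsAvoidingTransversal A.1 k X →
      ∃ j ∈ I, IsAvoidingTransversal A.1 j X := by
  by_cases hk : k ∈ I
  · exact iff_of_true (.inl hk) fun X _ h => ⟨k, hk, h⟩
  rw [mem_sigma_iff A hx hk]
  constructor
  swap
  · intro h X hX hXi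
    have hXE := hX.trans sdiff_subset
    exact h X hXE (((A.indep_iff hXE).1 hXi).avoiding fun e he => (hX he).2)
  intro h X hXE hXk
  have hxX : x ∉ X := fun h => hx (hXE h)
  rw [← isPartialTransversal_extendSystem_insert_iff hxX (A.notMem hx)]
  have hxk : x ∉ extendSystem A.1 x I k := by rwa [mem_extendSystem_self (A.notMem hx k)]
  have hne : ∀ e ∈ X, e ≠ x := fun e he h => hxX (h ▸ he)
  have hY : IsAvoidingTransversal (extendSystem A.1 x I) k (insert x (X \ A.1 k)) := by
    refine IsPartialTransversal.avoiding ?_ ?_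
    · rw [isPartialTransversal_extendSystem_insert_iff (fun h => hxX h.1) (A.notMem hx)]
      refine h _ (sdiff_subset_sdiff_left hXE) ?_
      exact (A.indep_iff (sdiff_subset.trans hXE)).2 (hXk.isPartialTransversal.subset sdiff_subset)
    · rintro e (rfl | he)
      · exact hxk
      · rw [mem_extendSystem_of_ne (hne e he.1)]
        exact he.2
  -- Augment within the transversal matroid whose `k`-th set is made empty.
  set N := transversalMatroid (insert x M.E) (Function.update (extendSystem A.1 x I) k ∅) with hN
  have hNi : ∀ Z ⊆ insert x X, (N.Indep Z ↔ IsAvoidingTransversal (extendSystem A.1 x I) k Z) := by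
    intro Z hZ
    rw [hN, transversalMatroid_indep_iff, isPartialTransversal_update_iff,
      and_iff_right (hZ.trans (insert_subset_insert hXE))]
  have hYX : insert x (X \ A.1 k) ⊆ insert x X := insert_subset_insert sdiff_subset
  obtain ⟨Z, hZ, hYZ⟩ := ((hNi _ hYX).2 hY).subset_isBasis_of_subset hYX
    (insert_subset_insert hXE)
  have hZk := (hNi Z hZ.subset).1 hZ.indep
  by_cases hZX : insert x X ⊆ Z
  · exact (hZk.subset hZX).isPartialTransversal
  obtain ⟨e, he, heZ⟩ := not_subset.1 hZX
  have heX : e ∈ X := he.resolve_left fun h => heZ (h ▸ hYZ (mem_insert _ _))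
  have hek : e ∈ A.1 k := by
    by_contra hek
    exact heZ (hYZ (mem_insert_of_mem _ ⟨heX, hek⟩))
  have hXfin : X.Finite := finite_of_encard_le_coe hXk.isPartialTransversal.encard_le
  have hcard : X.encard ≤ Z.encard := by
    rw [← hZ.eRk_eq_encard]
    refine Matroid.Indep.encard_le_eRk_of_subset ?_ (subset_insert _ _)
    exact (hNi X (subset_insert _ _)).2 ((isAvoidingTransversal_extendSystem_iff hxX).2 hXk)
  -- `Z` has at least as many elements as `X`, so `e` is the only element of `X ∪ {x}` that it
  -- misses.
  have hZe : Z = insert x X \ {e} := by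
    have hZsub : Z ⊆ insert x X \ {e} := fun z hz => ⟨hZ.subset hz, fun h => heZ (h ▸ hz)⟩
    refine ((hXfin.insert x).subset hZ.subset).eq_of_subset_of_encard_le hZsub ?_
    refine le_trans ?_ hcard
    rw [← ENat.add_le_add_iff_right ENat.one_ne_top, encard_sdiff_singleton_add_one he,
      encard_insert_of_notMem hxX]
  rw [show insert x X = insert e Z by rw [hZe, insert_sdiff_self_of_mem he],
    isPartialTransversal_insert_iff heZ]
  exact ⟨k, (mem_extendSystem_of_ne (hne e heX)).2 hek, hZk⟩

/-! ### The bijection between closed sets and extensions -/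

theorem ncard_extensions_eq (A : Presentation M r) {x : α} (hx : x ∉ M.E) :
    (extensions A x).ncard = (closedSets A x).ncard := by
  have h : extensions A x = extension A x '' closedSets A x := by
    ext N
    constructor
    · rintro ⟨I, rfl⟩
      have hI : extension A x (sigma A x I) = extension A x I := by
        refine (extension_eq_iff A hx).2 fun X hX => ⟨?_, fun ⟨k, hk, h⟩ => ⟨k, .inl hk, h⟩⟩
        rintro ⟨k, hk, hkX⟩
        exact (mem_sigma_iff_forall_avoiding A hx).1 hk X hX hkX
      refine ⟨sigma A x I, mem_closedSets_iff.2 fun k hk => ?_, hI⟩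
      rw [mem_sigma_iff_forall_avoiding A hx] at hk ⊢
      exact fun X hX hkX => ((extension_eq_iff A hx).1 hI X hX).1 (hk X hX hkX)
    · rintro ⟨I, -, rfl⟩
      exact ⟨I, rfl⟩
  -- A closed set contains every index set that defines the same extension; this gives injectivity
  -- on closed sets.
  have hsub : ∀ I J, J ∈ closedSets A x → extension A x I = extension A x J → I ⊆ J := by
    intro I J hJ hIJ k hk
    refine mem_closedSets_iff.1 hJ k ((mem_sigma_iff_forall_avoiding A hx).2 fun X hX hkX => ?_)
    exact ((extension_eq_iff A hx).1 hIJ X hX).1 ⟨k, hk, hkX⟩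
  rw [h]
  refine InjOn.ncard_image fun I hI J hJ hIJ => ?_
  exact (hsub I J hJ hIJ).antisymm (hsub J I hI hIJ.symm)

/-! ### Deficiencies bound the rank of a presentation -/

/-- The rank deficiency `r - 1 - r(M \ A_k)`. -/
noncomputable def deficiency (A : Presentation M r) (k : Fin r) : ℕ :=
  r - 1 - (M.eRk (M.E \ A.1 k)).toNat

theorem Presentation.eRk_sdiff_add_one_le (A : Presentation M r) (k : Fin r) :
    M.eRk (M.E \ A.1 k) + 1 ≤ r := by
  obtain ⟨X, hX⟩ := M.exists_isBasis (M.E \ A.1 k)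
  rw [hX.eRk_eq_encard]
  exact (((A.indep_iff hX.indep.subset_ground).1 hX.indep).avoiding
    fun e he => (hX.subset he).2).encard_add_one_le

/-- Ensures that neither `toNat` nor the truncated subtractions in `deficiency` lose information. -/
theorem Presentation.exists_eRk_eq (A : Presentation M r) (k : Fin r) :
    ∃ n : ℕ, M.eRk (M.E \ A.1 k) = n ∧ n + 1 ≤ r := by
  have h := A.eRk_sdiff_add_one_le k
  have hne : M.eRk (M.E \ A.1 k) ≠ ⊤ :=
    ne_top_of_le_ne_top (ENat.natCast_ne_top r) (le_self_add.trans h)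
  obtain ⟨n, hn⟩ := ENat.ne_top_iff_exists.1 hne
  rw [← hn] at h ⊢
  exact ⟨n, rfl, by exact_mod_cast h⟩

/-- A basis of `M \ B_k` is matched by `B` without `k`, so `e` can be matched to `k`. The enlarged
set is independent in `M` and still avoids `A_k`. -/
theorem eRk_lt_of_mem_sdiff {A B : Presentation M r} {k : Fin r} {e : α} (hAB : A ≤ B)
    (heB : e ∈ B.1 k) (heA : e ∉ A.1 k) : M.eRk (M.E \ B.1 k) < M.eRk (M.E \ A.1 k) := by
  obtain ⟨X, hX⟩ := M.exists_isBasis (M.E \ B.1 k)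
  have heX : e ∉ X := fun h => (hX.subset h).2 heB
  have heE : e ∈ M.E := B.2.1 k heB
  have hXE := hX.indep.subset_ground
  have hi : M.Indep (insert e X) := by
    rw [B.indep_iff (insert_subset heE hXE), isPartialTransversal_insert_iff heX]
    exact ⟨k, heB, ((B.indep_iff hXE).1 hX.indep).avoiding fun a ha => (hX.subset ha).2⟩
  have hle := hi.encard_le_eRk_of_subset (X := M.E \ A.1 k) (insert_subset ⟨heE, heA⟩
    fun a ha => ⟨hXE ha, fun h => (hX.subset ha).2 (hAB k h)⟩)
  rw [encard_insert_of_notMem heX] at hle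
  rw [hX.eRk_eq_encard]
  refine lt_of_lt_of_le ?_ hle
  exact (ENat.lt_add_one_iff
    (ne_top_of_le_ne_top (ENat.natCast_ne_top r) (B.encard_le hX.indep))).2 le_rfl

theorem sum_deficiency_strictMono :
    StrictMono fun A : Presentation M r => ∑ k, deficiency A k := by
  intro A B hAB
  have hle : A ≤ B := hAB.le
  obtain ⟨k, hk⟩ : ∃ k, ¬ B.1 k ⊆ A.1 k := by
    by_contra! h
    exact hAB.not_ge h
  obtain ⟨e, heB, heA⟩ := not_subset.1 hk
  refine Finset.sum_lt_sum (fun j _ => ?_) ⟨k, Finset.mem_univ k, ?_⟩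
  · obtain ⟨a, ha, -⟩ := A.exists_eRk_eq j
    obtain ⟨b, hb, -⟩ := B.exists_eRk_eq j
    have h := M.eRk_mono (sdiff_subset_sdiff_right (s := M.E) (hle j))
    rw [ha, hb] at h
    have h' : b ≤ a := by exact_mod_cast h
    simp only [deficiency, ha, hb, ENat.toNat_natCast]
    omega
  · obtain ⟨a, ha, har⟩ := A.exists_eRk_eq k
    obtain ⟨b, hb, -⟩ := B.exists_eRk_eq k
    have h := eRk_lt_of_mem_sdiff hle heB heA
    rw [ha, hb] at h
    have h' : b < a := by exact_mod_cast h
    simp only [deficiency, ha, hb, ENat.toNat_natCast]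
    omega

theorem height_le_sum_deficiency (A : Presentation M r) :
    Order.height A ≤ (∑ k, deficiency A k : ℕ) := by
  have h := Order.height_le_height_apply_of_strictMono _ (sum_deficiency_strictMono (M := M)) A
  simpa using h

/-! ### Implications satisfied by closed sets -/

/-- Every closed set that contains `j` contains `k`. -/
def Forces (A : Presentation M r) (x : α) (k j : Fin r) : Prop :=
  ∀ I ∈ closedSets A x, j ∈ I → k ∈ I

/-- Fix a matching of a basis of `M \ A_k`. An index outside its range is left free for `x`, so its
presence in `I` puts `k` into `σ(I)`. Only the matched indices can fail to force `k`. -/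
theorem encard_not_forces_le (A : Presentation M r) {x : α} (hx : x ∉ M.E) (k : Fin r) :
    {j | ¬ Forces A x k j}.encard ≤ M.eRk (M.E \ A.1 k) := by
  obtain ⟨X, hX⟩ := M.exists_isBasis (M.E \ A.1 k)
  obtain ⟨φ, hφ⟩ := (A.indep_iff hX.indep.subset_ground).1 hX.indep
  have hsub : {j | ¬ Forces A x k j} ⊆ range φ := by
    intro j hj
    simp only [Forces, mem_ofPred_eq, not_forall] at hj
    obtain ⟨I, hI, hjI, hkI⟩ := hj
    by_contra hjφ
    refine hkI (mem_closedSets_iff.1 hI k ((mem_sigma_iff_of_isBasis A hx hkI hX).2 ?_))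
    exact ⟨j, hjI, φ, hφ, fun e he => hjφ ⟨e, he⟩⟩
  rw [hX.eRk_eq_encard]
  refine (encard_le_encard hsub).trans_eq ?_
  rw [← image_univ, hφ.1.encard_image, encard_univ, ENat.card_coe_set_eq]

theorem sum_deficiency_le (A : Presentation M r) {x : α} (hx : x ∉ M.E) :
    ∑ k, deficiency A k ≤ (offDiagPairs (Forces A x) Finset.univ).card := by
  classical
  have h : (offDiagPairs (Forces A x) Finset.univ).card =
      ∑ k, (Finset.univ.filter fun j => k ≠ j ∧ Forces A x k j).card := by
    rw [Finset.card_eq_sum_card_fiberwise (f := Prod.fst) (t := Finset.univ) (by simp)]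
    refine Finset.sum_congr rfl fun k _ => ?_
    rw [← Finset.card_image_of_injective (Finset.univ.filter fun j => k ≠ j ∧ Forces A x k j)
      (Prod.mk_right_injective k)]
    refine congrArg Finset.card ?_
    ext ⟨a, b⟩
    simp only [offDiagPairs, Finset.mem_filter, Finset.mem_offDiag, Finset.mem_univ, true_and,
      Finset.mem_image, Prod.mk.injEq]
    constructor
    · rintro ⟨h, rfl⟩
      exact ⟨b, h, rfl, rfl⟩
    · rintro ⟨c, h, rfl, rfl⟩
      exact ⟨h, rfl⟩
  rw [h]
  refine Finset.sum_le_sum fun k _ => ?_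
  obtain ⟨n, hn, -⟩ := A.exists_eRk_eq k
  have h1 := encard_not_forces_le A hx k
  have h2 : {j | ¬ Forces A x k j} =
      ((Finset.univ.filter fun j => ¬ Forces A x k j : Finset (Fin r)) : Set (Fin r)) := by
    ext; simp
  rw [hn, h2, encard_coe_eq_coe_finsetCard] at h1
  have h3 : (Finset.univ.filter fun j => ¬ Forces A x k j).card ≤ n := by exact_mod_cast h1
  -- Discarding the trivial pair `(k, k)` leaves `r - 1` candidates `j`, whence the `r - 1` in
  -- `deficiency`.
  have h4 : (Finset.univ.erase k) ⊆ (Finset.univ.filter fun j => ¬ Forces A x k j) ∪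
      (Finset.univ.filter fun j => k ≠ j ∧ Forces A x k j) := by
    intro j hj
    simp only [Finset.mem_erase, Finset.mem_union, Finset.mem_filter, Finset.mem_univ] at hj ⊢
    by_cases hf : Forces A x k j
    · exact .inr ⟨trivial, hj.1.symm, hf⟩
    · exact .inl ⟨trivial, hf⟩
  have h5 := (Finset.card_le_card h4).trans (Finset.card_union_le _ _)
  rw [Finset.card_erase_of_mem (Finset.mem_univ k), Finset.card_univ, Fintype.card_fin] at h5
  rw [deficiency, hn, ENat.toNat_natCast]
  omega

theorem ncard_closedSets_le_card_closedUnder (A : Presentation M r) (x : α) :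
    (closedSets A x).ncard ≤ (closedUnder (Forces A x) Finset.univ).card := by
  classical
  rw [← ncard_coe_finset]
  refine ncard_le_ncard_of_injOn (fun I => I.toFinset) (fun I hI => ?_)
    (fun I _ J _ h => toFinset_inj.1 h) (Finset.finite_toSet _)
  refine Finset.mem_coe.2 (mem_closedUnder.2 ⟨Finset.subset_univ _, fun a _ b _ hab hb => ?_⟩)
  rw [mem_toFinset] at hb ⊢
  exact hab I hI hb

/-- The number of closed sets of a presentation of rank `i` is at most `(1/2 + 1/2^(i+1)) 2^r`. -/
theorem ncard_closedSets_le (A : Presentation M r) {x : α} (hx : x ∉ M.E) {i : ℕ}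
    (hi : Order.height A = (i : ℕ∞)) :
    ((closedSets A x).ncard : ℝ) ≤ (1 / 2 + 1 / 2 ^ (i + 1)) * 2 ^ r := by
  have h1 : i ≤ (offDiagPairs (Forces A x) Finset.univ).card := by
    refine le_trans ?_ (sum_deficiency_le A hx)
    have := height_le_sum_deficiency A
    rw [hi] at this
    exact_mod_cast this
  have h2 : ((closedSets A x).ncard : ℝ) ≤ (closedUnder (Forces A x) Finset.univ).card := by
    exact_mod_cast ncard_closedSets_le_card_closedUnder A x
  refine (h2.trans (card_closedUnder_le _ _)).trans ?_
  rw [Finset.card_univ, Fintype.card_fin, mul_comm]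
  refine mul_le_mul_of_nonneg_right ?_ (by positivity)
  have h3 : ((1 : ℝ) / 2) ^ (offDiagPairs (Forces A x) Finset.univ).card ≤ (1 / 2) ^ i :=
    pow_le_pow_of_le_one (by norm_num) (by norm_num) h1
  have h4 : (1 : ℝ) / 2 ^ (i + 1) = 1 / 2 * (1 / 2) ^ i := by
    rw [pow_succ, one_div_pow]
    field_simp
  linarith

theorem ncard_closedSets_le_of_le (A : Presentation M r) {x : α} (hx : x ∉ M.E) {i : ℕ}
    (hi : Order.height A = (i : ℕ∞)) (hr : 1 ≤ r) (hri : r ≤ i) :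
    (closedSets A x).ncard ≤ 2 ^ (r - 1) := by
  have h := ncard_closedSets_le A hx hi
  obtain ⟨s, rfl⟩ : ∃ s, r = s + 1 := ⟨r - 1, by omega⟩
  have h1 : (1 : ℝ) / 2 ^ (i + 1) ≤ 1 / 2 ^ (s + 2) :=
    one_div_le_one_div_of_le (by positivity) (pow_le_pow_right₀ (by norm_num) (by omega))
  have h2 : ((1 : ℝ) / 2 + 1 / 2 ^ (s + 2)) * 2 ^ (s + 1) = 2 ^ s + 1 / 2 := by
    rw [pow_succ, pow_succ]
    field_simp
  -- For `i ≥ r` the real bound is at most `2 ^ (r - 1) + 1/2`, so integrality removes the excess.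
  have h3 : ((closedSets A x).ncard : ℝ) < (2 ^ s + 1 : ℕ) := by
    have := mul_le_mul_of_nonneg_right h1 (show (0 : ℝ) ≤ 2 ^ (s + 1) by positivity)
    push_cast
    linarith
  exact Nat.lt_succ_iff.1 (by exact_mod_cast h3)

/-! ### Sharpness: the fan system -/

/-- The set system with `A_0 = {0, …, j}` and `A_k = {k}` for `0 < k < r`. -/
def fanSystem (r j : ℕ) : Fin r → Set ℕ :=
  fun k => {e | e = k ∨ (k : ℕ) = 0 ∧ e ≤ j}

/-- The system `fanSystem r j` as a presentation of the free matroid on `{0, …, r - 1}`. -/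
def fanPresentation {r j : ℕ} (hj : j < r) : Presentation (Matroid.freeOn (Iio r)) r :=
  ⟨fanSystem r j, by
    rintro i e (rfl | ⟨-, he⟩)
    · exact i.2
    · exact he.trans_lt hj, by
    refine Matroid.eq_freeOn_iff.2 ⟨rfl, (transversalMatroid_indep_iff _ _ _).2 ⟨Subset.rfl, ?_⟩⟩
    exact ⟨fun e => ⟨e, e.2⟩, fun a b hab => Subtype.ext (Fin.mk.inj_iff.1 hab), fun e => .inl rfl⟩⟩

/-- Removing the elements `j, j - 1, …, 1` from `A_0` one at a time gives a chain of `j` strict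
steps among presentations of the same free matroid. -/
theorem le_height_fanPresentation {r j : ℕ} (hj : j < r) :
    (j : ℕ∞) ≤ Order.height (fanPresentation hj) := by
  induction j with
  | zero => simp
  | succ j ih =>
    have hlt : fanPresentation (Nat.lt_of_succ_lt hj) < fanPresentation hj := by
      refine lt_of_le_not_ge (fun k e he => he.imp_right fun h => ⟨h.1, h.2.trans j.le_succ⟩)
        fun h => ?_
      have h0 : (j + 1) ∈ (fanPresentation (Nat.lt_of_succ_lt hj)).1 ⟨0, by omega⟩ :=
        h _ (.inr ⟨rfl, le_rfl⟩)
      rcases h0 with h0 | h0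
      · exact absurd h0 (Nat.succ_ne_zero j)
      · exact absurd h0.2 (Nat.not_succ_le_self j)
    refine le_trans ?_ (Order.height_add_one_le hlt)
    push_cast
    gcongr
    exact ih _

/-- In the free matroid rank is cardinality: the complement of `A_0` has `r - 1 - j` elements, that
of any other `A_k` has `r - 1`. -/
theorem deficiency_fanPresentation {r j : ℕ} (hj : j < r) (k : Fin r) :
    deficiency (fanPresentation hj) k ≤ if (k : ℕ) = 0 then j else 0 := by
  have hsub : (Matroid.freeOn (Iio r)).E \ (fanPresentation hj).1 k ⊆ Iio r := sdiff_subset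
  rw [deficiency, Matroid.eRk_freeOn hsub]
  split_ifs with hk
  · have h : (Matroid.freeOn (Iio r)).E \ (fanPresentation hj).1 k = (Finset.Ioo j r : Set ℕ) := by
      ext e
      simp only [Matroid.freeOn_ground, fanPresentation, fanSystem, mem_sdiff, mem_Iio,
        mem_ofPred_eq, Finset.coe_Ioo, mem_Ioo]
      omega
    rw [h, encard_coe_eq_coe_finsetCard, Nat.card_Ioo, ENat.toNat_natCast]
    omega
  · have h : (Matroid.freeOn (Iio r)).E \ (fanPresentation hj).1 k =
        ((Finset.range r).erase k : Set ℕ) := by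
      ext e
      simp only [Matroid.freeOn_ground, fanPresentation, fanSystem, mem_sdiff, mem_Iio,
        mem_ofPred_eq, Finset.coe_erase, Finset.coe_range, mem_singleton_iff]
      omega
    rw [h, encard_coe_eq_coe_finsetCard, Finset.card_erase_of_mem (Finset.mem_range.2 k.2),
      Finset.card_range, ENat.toNat_natCast, Nat.sub_self]

theorem height_fanPresentation {r j : ℕ} (hj : j < r) :
    Order.height (fanPresentation hj) = (j : ℕ∞) := by
  refine le_antisymm ((height_le_sum_deficiency _).trans ?_) (le_height_fanPresentation hj)
  refine Nat.cast_le.2 ((Finset.sum_le_sum fun k _ => deficiency_fanPresentation hj k).trans ?_)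
  rw [Finset.sum_eq_single ⟨0, by omega⟩]
  · simp
  · intro k _ hk
    exact if_neg fun h => hk (Fin.ext h)
  · simp

theorem mem_closedSets_fanPresentation {r j : ℕ} (hj : j < r) {I : Set (Fin r)}
    (hI : ⟨0, by omega⟩ ∈ I ∨ ∀ k ∈ I, j < (k : ℕ)) :
    I ∈ closedSets (fanPresentation hj) r := by
  refine mem_closedSets_iff.2 fun k hk => ?_
  by_contra hkI
  rw [mem_sigma_iff _ (by simp) hkI] at hk
  have hX : Fin.val '' I ⊆ (Matroid.freeOn (Iio r)).E := by
    rintro - ⟨a, -, rfl⟩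
    exact a.2
  -- If `k ∉ I` were in `σ(I)`, the set `I` itself, read as a set of elements, would avoid `A_k` and
  -- be matched without some `l ∈ I`. Its elements can only be matched to indices in `I`, so an
  -- injection of `I` into `I \ {l}` would result.
  obtain ⟨l, hl, φ, ⟨hinj, hmem⟩, hφ⟩ := hk (Fin.val '' I) (by
    rintro - ⟨a, ha, rfl⟩
    refine ⟨a.2, ?_⟩
    rintro (h | ⟨h, h'⟩)
    · exact hkI (Fin.ext h ▸ ha)
    · rcases hI with hI | hI
      · exact hkI (by rwa [show k = ⟨0, by omega⟩ from Fin.ext h])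
      · exact absurd (hI a ha) (not_lt.2 h')) (Matroid.freeOn_indep hX)
  have hsub : range φ ⊆ I \ {l} := by
    rintro - ⟨⟨-, a, ha, rfl⟩, rfl⟩
    refine ⟨?_, hφ _⟩
    rcases hmem ⟨a, a, ha, rfl⟩ with h | ⟨h, h'⟩
    · rwa [show φ ⟨a, a, ha, rfl⟩ = a from Fin.ext h.symm]
    · rcases hI with hI | hI
      · rwa [show φ ⟨a, a, ha, rfl⟩ = ⟨0, by omega⟩ from Fin.ext h]
      · exact absurd (hI a ha) (not_lt.2 h')
  have h1 : (range φ).ncard = I.ncard := by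
    rw [← image_univ, ncard_image_of_injective _ hinj, ncard_univ, Nat.card_coe_set_eq,
      ncard_image_of_injective _ Fin.val_injective]
  have h2 := ncard_le_ncard hsub
  have h3 := ncard_sdiff_singleton_lt_of_mem hl
  omega

theorem le_ncard_closedSets_fanPresentation {r j : ℕ} (hj : j < r) :
    2 ^ (r - 1) + 2 ^ (r - 1 - j) ≤ (closedSets (fanPresentation hj) r).ncard := by
  classical
  set o : Fin r := ⟨0, by omega⟩
  -- The `2 ^ (r - 1)` sets containing `0`, and the `2 ^ (r - 1 - j)` sets of indices above `j`.
  -- Their number equals the general upper bound, so no other closed sets exist.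
  set F : Finset (Finset (Fin r)) :=
    Finset.Icc {o} Finset.univ ∪ (Finset.Ioi (⟨j, hj⟩ : Fin r)).powerset with hF
  have hcard : F.card = 2 ^ (r - 1) + 2 ^ (r - 1 - j) := by
    rw [hF, Finset.card_union_of_disjoint, Finset.card_Icc_finset (Finset.subset_univ _),
      Finset.card_powerset, Fin.card_Ioi, Finset.card_univ, Fintype.card_fin,
      Finset.card_singleton]
    rw [Finset.disjoint_left]
    intro I hI hI'
    have h0 : o ∈ I := (Finset.mem_Icc.1 hI).1 (Finset.mem_singleton_self o)
    have := Finset.mem_Ioi.1 (Finset.mem_powerset.1 hI' h0)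
    exact absurd this (not_lt.2 (Nat.zero_le j))
  rw [← hcard, ← ncard_coe_finset]
  refine ncard_le_ncard_of_injOn (fun I => (I : Set (Fin r))) (fun I hI => ?_)
    Finset.coe_injective.injOn
  refine mem_closedSets_fanPresentation hj ?_
  rcases Finset.mem_union.1 (Finset.mem_coe.1 hI) with h | h
  · exact .inl ((Finset.mem_Icc.1 h).1 (Finset.mem_singleton_self o))
  · exact .inr fun k hk => Fin.lt_def.1 (Finset.mem_Ioi.1 (Finset.mem_powerset.1 h hk))

theorem ncard_closedSets_fanPresentation {r j : ℕ} (hj : j < r) :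
    ((closedSets (fanPresentation hj) r).ncard : ℝ) = (1 / 2 + 1 / 2 ^ (j + 1)) * 2 ^ r := by
  refine le_antisymm (ncard_closedSets_le _ (by simp) (height_fanPresentation hj)) ?_
  have h : ((2 ^ (r - 1) + 2 ^ (r - 1 - j) : ℕ) : ℝ) ≤
      (closedSets (fanPresentation hj) r).ncard :=
    Nat.cast_le.2 (le_ncard_closedSets_fanPresentation hj)
  refine le_of_eq_of_le ?_ h
  obtain ⟨s, rfl⟩ : ∃ s, r = j + s + 1 := ⟨r - 1 - j, by omega⟩
  rw [show j + s + 1 - 1 - j = s by omega, Nat.add_sub_cancel]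
  push_cast
  rw [pow_succ, pow_succ, pow_add]
  field_simp

end TransversalMatroid

theorem mainTheorem5 (r : ℕ) (hr : 1 ≤ r) :
    (∀ {α : Type*} (M : Matroid α) [M.Finite], M.eRank = (r : ℕ∞) →
      ∀ (A : TransversalMatroid.Presentation M r) (i : ℕ), Order.height A = (i : ℕ∞) →
      ∀ x : α, x ∉ M.E →
        (1 ≤ i → i < r →
          (TransversalMatroid.extensions A x).ncard =
              (TransversalMatroid.closedSets A x).ncard ∧
            ((TransversalMatroid.closedSets A x).ncard : ℝ) ≤
              (1 / 2 + 1 / 2 ^ (i + 1)) * 2 ^ r) ∧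
        (r ≤ i →
          (TransversalMatroid.extensions A x).ncard =
              (TransversalMatroid.closedSets A x).ncard ∧
            (TransversalMatroid.closedSets A x).ncard ≤ 2 ^ (r - 1))) ∧
    (∀ i : ℕ, 1 ≤ i → i < r →
      ∃ (M : Matroid ℕ) (A : TransversalMatroid.Presentation M r) (x : ℕ),
        M.Finite ∧ M.eRank = (r : ℕ∞) ∧ Order.height A = (i : ℕ∞) ∧ x ∉ M.E ∧
        (TransversalMatroid.extensions A x).ncard =
            (TransversalMatroid.closedSets A x).ncard ∧
          ((TransversalMatroid.closedSets A x).ncard : ℝ) =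
            (1 / 2 + 1 / 2 ^ (i + 1)) * 2 ^ r) := by
  refine ⟨?_, ?_⟩
  · intro α M _ _ A i hi x hx
    exact ⟨fun _ _ => ⟨TransversalMatroid.ncard_extensions_eq A hx,
        TransversalMatroid.ncard_closedSets_le A hx hi⟩,
      fun hri => ⟨TransversalMatroid.ncard_extensions_eq A hx,
        TransversalMatroid.ncard_closedSets_le_of_le A hx hi hr hri⟩⟩
  · intro i _ hi
    have hE : (Set.Iio r).encard = (r : ℕ∞) := by
      rw [← Finset.coe_Iio, Set.encard_coe_eq_coe_finsetCard, Nat.card_Iio]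
    have hx : r ∉ (Matroid.freeOn (Set.Iio r)).E := by simp
    exact ⟨Matroid.freeOn (Set.Iio r), TransversalMatroid.fanPresentation hi, r,
      ⟨Set.finite_Iio r⟩, by simp [hE], TransversalMatroid.height_fanPresentation hi, hx,
      TransversalMatroid.ncard_extensions_eq _ hx,
      TransversalMatroid.ncard_closedSets_fanPresentation hi⟩
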